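/- **Theorem 5.4.** Every free homogeneous structure over a finite relational language has ample generics. In detail, let $\mathcal L$ be a relational language with finitely many relation symbols. * Let $A, B_1, B_2$ be finite $\mathcal L$-structures with $A\subseteq B_1$ and $A\subseteq B_2$. The *free amalgam* of $B_1$ and $B_2$ over $A$ is the $\mathcal L$-structure $C$ whose domain is the disjoint union of $B_1$ and $B_2$ over $A$ (so that $C=B_1\cup B_2$ and $B_1\cap B_2=A$), with $R^C=R^{B_1}\cup R^{B_2}$ for every $R\in\mathcal L$. * A *free amalgamation class* is a class $\mathcal C$ of finite $\mathcal L$-structures with countably infinitely many isomorphism types that is closed under isomorphism, has the hereditary property, the joint embedding property and the amalgamation property (i.e. is a Fraïssé class), and is closed under taking free amalgams of its members over members. * A *free homogeneous structure* is the Fraïssé limit $M$ of a free amalgamation class $\mathcal C$: a countable structure in which every isomorphism between finite substructures extends to an automorphism, and whose age (the class of finite structures embeddable in $M$) is $\mathcal C$. Let $M$ be a free homogeneous $\mathcal L$-structure and give $G=\mathrm{Aut}(M)$ the topology of pointwise convergence, where $M$ is discrete. Then $G$ is a Polish group, and for every $n\ge 1$ the action of $G$ on $G^n$ by diagonal conjugation,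 $$g\cdot(h_1,\dots,h_n)=(gh_1g^{-1},\dots,gh_ng^{-1}),$$ has a comeagre orbit. -/

import Mathlib

open scoped FirstOrder

universe u v w

namespace FreeHomogeneous

open FirstOrder FirstOrder.Language FirstOrder.Language.Structure

/-! ### Free amalgamation classes and free homogeneous structures -/

section Structures

variable {L : FirstOrder.Language.{u, v}}

/-- The structure `C`, with the embeddings `g₁ : B₁ ↪ C` and `g₂ : B₂ ↪ C`, is the free amalgam of
`B₁` and `B₂` over `A` (where `A` is seen as a substructure of `B₁` and of `B₂` through `f₁` and
`f₂`). When `B₁` and `B₂` are identified with their images in `C`, this says that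
`C = B₁ ∪ B₂`, `B₁ ∩ B₂ = A`, and `R^C = R^{B₁} ∪ R^{B₂}` for every relation symbol `R`. -/
structure IsFreeAmalgam {A B₁ B₂ C : Type w}
    [L.Structure A] [L.Structure B₁] [L.Structure B₂] [L.Structure C]
    (f₁ : A ↪[L] B₁) (f₂ : A ↪[L] B₂) (g₁ : B₁ ↪[L] C) (g₂ : B₂ ↪[L] C) : Prop where
  comm : ∀ a, g₁ (f₁ a) = g₂ (f₂ a)
  union_eq : Set.range g₁ ∪ Set.range g₂ = Set.univ
  inter_eq : Set.range g₁ ∩ Set.range g₂ = Set.range (fun a => g₁ (f₁ a))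
  rel_iff : ∀ {n : ℕ} (R : L.Relations n) (x : Fin n → C),
    RelMap R x ↔
      (∃ y : Fin n → B₁, RelMap R y ∧ x = g₁ ∘ y) ∨ (∃ y : Fin n → B₂, RelMap R y ∧ x = g₂ ∘ y)

/-- The free amalgamation property: the class `K` is closed under taking free amalgams. -/
def FreeAmalgamation (K : Set (CategoryTheory.Bundled.{w} L.Structure)) : Prop :=
  ∀ (A B₁ B₂ C : CategoryTheory.Bundled.{w} L.Structure)
    (f₁ : A ↪[L] B₁) (f₂ : A ↪[L] B₂) (g₁ : B₁ ↪[L] C) (g₂ : B₂ ↪[L] C),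
    A ∈ K → B₁ ∈ K → B₂ ∈ K → IsFreeAmalgam f₁ f₂ g₁ g₂ → C ∈ K

/-- A free amalgamation class over a relational language: a Fraïssé class (of finite structures,
with countably infinitely many isomorphism types) that has the free amalgamation property.
Over a relational language, finitely generated means finite; closure under
isomorphism is part of `Hereditary`, and countability of the set of isomorphism types is part
of `IsFraisse`. -/
structure IsFreeAmalgamationClass [L.IsRelational]
    (K : Set (CategoryTheory.Bundled.{w} L.Structure)) : Prop where
  isFraisse : IsFraisse K
  infinite_types : (Quotient.mk' '' K).Infinite
  freeAmalgamation : FreeAmalgamation K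

variable (L) in
/-- A free homogeneous structure: the Fraïssé limit of a free amalgamation class. -/
def IsFreeHomogeneous [L.IsRelational] (M : Type w) [L.Structure M] [Countable M] : Prop :=
  ∃ K : Set (CategoryTheory.Bundled.{w} L.Structure),
    IsFreeAmalgamationClass K ∧ IsFraisseLimit K M

/-! ### The automorphism group, with the topology of pointwise convergence -/

/-- The automorphism group of `M`, under composition. -/
instance autGroup (M : Type w) [L.Structure M] : Group (M ≃[L] M) where
  mul g h := g.comp h
  one := FirstOrder.Language.Equiv.refl L M
  inv g := g.symm
  mul_assoc _ _ _ := rfl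
  one_mul _ := rfl
  mul_one _ := rfl
  inv_mul_cancel g := FirstOrder.Language.Equiv.ext fun x => g.symm_apply_apply x

/-- The topology of pointwise convergence on the automorphism group of `M`, where `M` is discrete:
the topology induced from the product topology on `M → M`. -/
instance autTopology (M : Type w) [L.Structure M] : TopologicalSpace (M ≃[L] M) :=
  TopologicalSpace.induced (fun g => (g : M → M)) (@Pi.topologicalSpace M (fun _ => M) fun _ => ⊥)

end Structures

/-! ### Ample generics -/

/-- The orbit of `h` in the action of `G` on `G ^ n` by diagonal conjugation. -/
def diagConjOrbit {G : Type w} [Group G] {n : ℕ} (h : Fin n → G) : Set (Fin n → G) :=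
  {k | ∃ g : G, k = fun i => g * h i * g⁻¹}

/-- `G` is a Polish group with ample generics: for every `n ≥ 1`, the action of `G` on `G ^ n` by
diagonal conjugation has a comeagre orbit. -/
structure HasAmpleGenerics (G : Type w) [Group G] [TopologicalSpace G] : Prop where
  isTopologicalGroup : IsTopologicalGroup G
  polishSpace : PolishSpace G
  exists_comeagre_orbit :
    ∀ n : ℕ, 1 ≤ n → ∃ h : Fin n → G, diagConjOrbit h ∈ residual (Fin n → G)

end FreeHomogeneous

/-! Call a tuple in `G ^ n` generic if every finite set lies in a finite invariant set, and if each
extension of its restriction to a finite invariant set `A`, by the action of another tuple on a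
larger finite invariant set, is realised by it over `A` up to conjugation. Any two generic tuples
are conjugate by back-and-forth along finite invariant sets (`IsGeneric.exists_conj`), so it
suffices that generic tuples are comeagre (`eventually_isGeneric`). Each of the two conditions is
reduced to countably many dense open sets, and density rests on two facts.

Density of tuples with large finite invariant sets (`exists_finite_invariant`) is the extension
property for partial automorphisms. A finite structure `A` has a finite extension `V` in which its
partial isomorphisms extend to automorphisms; relations of `V` are twisted by parities, which leave
enough freedom to correct any permutation of `A`. This `V` may fail to embed in `M`. A finite cover
of `V`, coloured so that no set that is unmovable into `A` can lift to a clique, gives an extension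
all of whose cliques move into `A` (`exists_faithful_extension`). A finite structure is built from
its cliques by free amalgamation, so this extension does embed in `M`.

Density of realisation (`exists_joint_realisation`) is free amalgamation of actions: when `C` is
moved to be free from `D` over `A`, automorphisms acting on the two sets and agreeing on `A` unite
to a partial isomorphism, which extends by homogeneity. -/

namespace FreeHomogeneous

open FirstOrder.Language.Structure

/-! ### Partial isomorphisms of relational structures -/

section PartialIso

variable {L : FirstOrder.Language.{u, v}}

variable (L) in
/-- The restriction of `f` to `S` is injective, and preserves and reflects all relations. -/
def IsPartialIso {M N : Type*} [L.Structure M] [L.Structure N] (S : Set M) (f : M → N) : Prop :=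
  S.InjOn f ∧ ∀ ⦃n : ℕ⦄ (R : L.Relations n) (x : Fin n → M), (∀ i, x i ∈ S) →
    (RelMap R (fun i => f (x i)) ↔ RelMap R x)

/-- A bijection preserving and reflecting all relations, as an isomorphism of relational
structures. -/
def equivOfRelMap [L.IsRelational] {M N : Type*} [L.Structure M] [L.Structure N] (e : M ≃ N)
    (h : ∀ ⦃n : ℕ⦄ (R : L.Relations n) (x : Fin n → M),
      RelMap R (fun i => e (x i)) ↔ RelMap R x) : M ≃[L] N where
  toEquiv := e
  map_fun' f := isEmptyElim f
  map_rel' R x := h R x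

/-- An injection preserving and reflecting all relations, as an embedding of relational
structures. -/
def embeddingOfRelMap [L.IsRelational] {M N : Type*} [L.Structure M] [L.Structure N] (f : M → N)
    (hf : Function.Injective f)
    (h : ∀ ⦃n : ℕ⦄ (R : L.Relations n) (x : Fin n → M),
      RelMap R (fun i => f (x i)) ↔ RelMap R x) : M ↪[L] N where
  toFun := f
  inj' := hf
  map_fun' f := isEmptyElim f
  map_rel' R x := h R x

theorem equiv_relMap {M N : Type*} [L.Structure M] [L.Structure N] (g : M ≃[L] N) {n : ℕ}
    (R : L.Relations n) (x : Fin n → M) : RelMap R (fun i => g (x i)) ↔ RelMap R x :=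
  g.map_rel R x

theorem embedding_relMap {M N : Type*} [L.Structure M] [L.Structure N] (g : M ↪[L] N) {n : ℕ}
    (R : L.Relations n) (x : Fin n → M) : RelMap R (fun i => g (x i)) ↔ RelMap R x :=
  g.map_rel R x

namespace IsPartialIso

variable {M N P : Type*} [L.Structure M] [L.Structure N] [L.Structure P]

theorem mono {S T : Set M} {f : M → N} (h : IsPartialIso L T f) (hST : S ⊆ T) :
    IsPartialIso L S f :=
  ⟨h.1.mono hST, fun _ R x hx => h.2 R x fun i => hST (hx i)⟩

theorem comp {S : Set M} {T : Set N} {f : M → N} {g : N → P} (hg : IsPartialIso L T g)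
    (hf : IsPartialIso L S f) (hST : Set.MapsTo f S T) : IsPartialIso L S fun x => g (f x) :=
  ⟨hg.1.comp hf.1 hST, fun _ R x hx =>
    (hg.2 R (fun i => f (x i)) fun i => hST (hx i)).trans (hf.2 R x hx)⟩

end IsPartialIso

theorem isPartialIso_equiv {M N : Type*} [L.Structure M] [L.Structure N] (g : M ≃[L] N)
    (S : Set M) : IsPartialIso L S g :=
  ⟨g.injective.injOn, fun _ R x _ => g.map_rel R x⟩

theorem isPartialIso_embedding {M N : Type*} [L.Structure M] [L.Structure N] (g : M ↪[L] N)
    (S : Set M) : IsPartialIso L S g :=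
  ⟨g.injective.injOn, fun _ R x _ => g.map_rel R x⟩

end PartialIso

/-! ### Extending partial isomorphisms of finite structures -/

/-- The hypothesis makes `u j ↦ v j` a well-defined injection on the range of `u`, and an injection
from a subset of a finite set extends to a bijection onto any set of the same size. This extends
both partial maps of points and partial matchings of colours. -/
theorem exists_equiv_comp_eq {J P Q : Type*} [Finite P] (e₀ : P ≃ Q) (u : J → P) (v : J → Q)
    (h : ∀ i j, u i = u j ↔ v i = v j) : ∃ e : P ≃ Q, ∀ j, e (u j) = v j := by
  classical
  have := Fintype.ofFinite P
  have := Fintype.ofEquiv P e₀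
  have hfac : Function.FactorsThrough v u := fun i j hij => (h i j).1 hij
  obtain ⟨g, hg⟩ := Finset.exists_equiv_extend_of_card_eq (α := P) (β := Q) (t := Finset.univ)
    (by rw [Finset.card_univ]; exact Fintype.card_congr e₀) (s := (Set.range u).toFinset)
    (f := Function.extend u v e₀) (Finset.subset_univ _) (by
      rintro a ha b hb hab
      obtain ⟨i, rfl⟩ := by simpa using ha
      obtain ⟨j, rfl⟩ := by simpa using hb
      rw [hfac.extend_apply, hfac.extend_apply] at hab
      exact (h i j).2 hab)
  refine ⟨g.trans (Equiv.subtypeUnivEquiv fun x => Finset.mem_univ x), fun j => ?_⟩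
  have := hg (u j) (by simp)
  rw [hfac.extend_apply] at this
  simpa using this

section Extension

variable {L : FirstOrder.Language.{u, v}}

variable (L) in
/-- The coordinates of the valuations of `Valued L A`: places in tuples of `A`, labelled by a
relation symbol. -/
abbrev Place (A : Type w) : Type (max v w) :=
  Σ R : (Σ n, L.Relations n), (Fin R.1 → A) × Fin R.1

variable (L) in
/-- Elements of `A` together with a valuation of all places. -/
def Valued (A : Type w) : Type (max v w) := A × (Place L A → ZMod 2)

open Classical in
/-- The truth value of a relation, as an element of the field with two elements. -/
noncomputable def truth {A : Type w} [L.Structure A] {n : ℕ} (R : L.Relations n)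
    (x : Fin n → A) : ZMod 2 := if RelMap R x then 1 else 0

theorem truth_eq_one {A : Type w} [L.Structure A] {n : ℕ} (R : L.Relations n)
    (x : Fin n → A) : truth R x = 1 ↔ RelMap R x := by
  unfold truth; split_ifs <;> simp_all

theorem truth_congr {A B : Type*} [L.Structure A] [L.Structure B] {n : ℕ} {R : L.Relations n}
    {x : Fin n → A} {y : Fin n → B} (h : RelMap R x ↔ RelMap R y) : truth R x = truth R y := by
  classical
  exact if_congr h rfl rfl

/-- If `t` lies in `S`, both truth values agree and no correction is needed. Otherwise a single
entry of `t` outside `S` carries the whole correction, so nothing changes over `S`. -/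
theorem exists_flip {A : Type w} [L.Structure A] {S : Set A} {p : A → A}
    (hp : IsPartialIso L S p) (φ : A ≃ A) (hφ : ∀ a ∈ S, φ a = p a) {n : ℕ} (R : L.Relations n)
    (t : Fin n → A) : ∃ f : Fin n → A → ZMod 2, (∀ i, ∀ a ∈ S, f i a = 0) ∧
      ∑ i, f i (t i) = truth R t - truth R (fun i => φ (t i)) := by
  classical
  by_cases ht : ∀ i, t i ∈ S
  · refine ⟨fun _ _ => 0, by simp, ?_⟩
    have : truth R (fun i => φ (t i)) = truth R t := by
      apply truth_congr
      simp only [hφ _ (ht _)]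
      exact hp.2 R t ht
    simp [this]
  · push Not at ht
    obtain ⟨i₀, hi₀⟩ := ht
    refine ⟨fun i a => if i = i₀ ∧ a ∉ S then truth R t - truth R (fun i => φ (t i)) else 0,
      fun i a ha => by simp [ha], ?_⟩
    rw [Finset.sum_eq_single i₀]
    · simp [hi₀]
    · intro i _ hi; simp [hi]
    · simp

variable [L.IsRelational]

variable (L) in
/-- An element with the zero valuation. -/
def Valued.base {A : Type w} (a : A) : Valued L A := (a, 0)

/-- A relation holds when it holds of the underlying tuple, up to the parity of the sum of the
valuations at the places of that tuple. -/
noncomputable instance (A : Type w) [L.Structure A] : L.Structure (Valued L A) where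
  funMap f := isEmptyElim f
  RelMap {n} R y :=
    ∑ i, (y i).2 ⟨⟨n, R⟩, fun j => (y j).1, i⟩ + truth R (fun j => (y j).1) = 1

theorem relMap_valued {A : Type w} [L.Structure A] {n : ℕ} (R : L.Relations n)
    (y : Fin n → Valued L A) : RelMap R y ↔
      ∑ i, (y i).2 ⟨⟨n, R⟩, fun j => (y j).1, i⟩ + truth R (fun j => (y j).1) = 1 := Iff.rfl

/-- Every finite relational structure has a finite extension in which all its partial
isomorphisms extend to automorphisms. -/
theorem exists_extension_of_partialIso [Finite (Σ n, L.Relations n)] (A : Type w) [L.Structure A]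
    [Finite A] : ∃ (B : Type (max v w)) (_ : L.Structure B) (_ : Finite B) (i : A ↪[L] B),
      ∀ (S : Set A) (p : A → A), IsPartialIso L S p →
        ∃ θ : B ≃[L] B, ∀ a ∈ S, θ (i a) = i (p a) := by
  classical
  refine ⟨Valued L A, inferInstance, ?_, embeddingOfRelMap (Valued.base L) ?_ ?_, ?_⟩
  · have : Finite (Place L A) := inferInstance
    exact inferInstanceAs (Finite (A × (Place L A → ZMod 2)))
  · intro a b h
    exact congrArg Prod.fst h
  · intro n R x
    rw [relMap_valued, ← truth_eq_one]
    simp [Valued.base]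
  intro S p hp
  obtain ⟨φ, hφ⟩ : ∃ φ : A ≃ A, ∀ a : S, φ a = p a :=
    exists_equiv_comp_eq (Equiv.refl A) (fun a : S => (a : A)) (fun a : S => p a) fun a b =>
      ⟨fun h => by rw [h], fun h => hp.1 a.2 b.2 h⟩
  replace hφ : ∀ a ∈ S, φ a = p a := fun a ha => hφ ⟨a, ha⟩
  choose f hf hfsum using fun (R : Σ n, L.Relations n) (t : Fin R.1 → A) =>
    exists_flip hp φ hφ R.2 t
  let τ : Place L A ≃ Place L A := Equiv.sigmaCongrRight fun R =>
    Equiv.prodCongr (Equiv.arrowCongr (Equiv.refl _) φ) (Equiv.refl _)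
  let F : A → Place L A → ZMod 2 := fun a q => f q.1 q.2.1 q.2.2 a
  -- The valuation of a point over `a` is shifted by the correction `F a`, and its places are then
  -- relabelled along `φ`. The shifts along a tuple sum to the change of truth value caused by `φ`,
  -- so the twisted relations are preserved.
  let e : Valued L A ≃ Valued L A := Equiv.prodShear φ fun a =>
    (Equiv.addRight (F a)).trans (Equiv.arrowCongr τ (Equiv.refl _))
  have he1 : ∀ y, (e y).1 = φ y.1 := fun y => rfl
  have he2 : ∀ y q, (e y).2 (τ q) = y.2 q + F y.1 q := by
    intro y q
    change (y.2 + F y.1) (τ.symm (τ q)) = _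
    rw [Equiv.symm_apply_apply]; rfl
  refine ⟨equivOfRelMap e ?_, ?_⟩
  · intro n R y
    rw [relMap_valued, relMap_valued]
    have h1 : ∀ i, (e (y i)).2 ⟨⟨n, R⟩, fun j => (e (y j)).1, i⟩ =
        (y i).2 ⟨⟨n, R⟩, fun j => (y j).1, i⟩ + f ⟨n, R⟩ (fun j => (y j).1) i (y i).1 :=
      fun i => he2 (y i) ⟨⟨n, R⟩, fun j => (y j).1, i⟩
    simp only [h1, Finset.sum_add_distrib]
    rw [hfsum ⟨n, R⟩ fun j => (y j).1]
    simp only [he1, add_assoc, sub_add_cancel]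
  · intro a ha
    refine Prod.ext (hφ a ha) (funext fun q => ?_)
    obtain ⟨q, rfl⟩ := τ.surjective q
    refine (he2 (Valued.base L a) q).trans ?_
    change 0 + f q.1 q.2.1 q.2.2 a = 0
    rw [hf _ _ _ a ha, add_zero]

/-- Every finite relational structure has a finite extension in which all its partial
isomorphisms extend to automorphisms, and every point of which can be moved into it. -/
theorem exists_covered_extension_of_partialIso [Finite (Σ n, L.Relations n)] (A : Type w)
    [L.Structure A] [Finite A] :
    ∃ (B : Type (max v w)) (_ : L.Structure B) (_ : Finite B) (i : A ↪[L] B),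
      (∀ (S : Set A) (p : A → A), IsPartialIso L S p →
        ∃ θ : B ≃[L] B, ∀ a ∈ S, θ (i a) = i (p a)) ∧
      ∀ b, ∃ θ : B ≃[L] B, θ b ∈ Set.range i := by
  obtain ⟨B, _, _, i, hi⟩ := exists_extension_of_partialIso (L := L) A
  -- The union of the orbits that meet the image of `A` is invariant, so automorphisms restrict to
  -- it.
  let V : L.Substructure B :=
    { carrier := {b | ∃ θ : B ≃[L] B, θ b ∈ Set.range i}
      fun_mem := fun f => isEmptyElim f }
  have hV : ∀ b, b ∈ V ↔ ∃ θ : B ≃[L] B, θ b ∈ Set.range i := fun b => Iff.rfl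
  have hiV : ∀ a, i a ∈ V := fun a => (hV _).2 ⟨1, a, rfl⟩
  have hinv : ∀ (θ : B ≃[L] B) b, b ∈ V ↔ θ b ∈ V := by
    intro θ b
    rw [hV, hV]
    constructor
    · rintro ⟨α, a, ha⟩
      refine ⟨α * θ⁻¹, a, ha.trans ?_⟩
      change _ = α (θ.symm (θ b))
      rw [θ.symm_apply_apply]
    · rintro ⟨α, a, ha⟩
      exact ⟨α * θ, a, ha⟩
  let res : (B ≃[L] B) → (V ≃[L] V) := fun θ =>
    equivOfRelMap (θ.toEquiv.subtypeEquiv (hinv θ)) fun n R x => θ.map_rel R fun i => (x i : B)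
  have hres : ∀ θ (b : V), ((res θ b : V) : B) = θ b := fun θ b => rfl
  refine ⟨V, inferInstance, inferInstance, embeddingOfRelMap (fun a => ⟨i a, hiV a⟩) ?_ ?_, ?_, ?_⟩
  · intro a b h
    exact i.injective (congrArg Subtype.val h)
  · intro n R x
    exact i.map_rel R x
  · intro S p hp
    obtain ⟨θ, hθ⟩ := hi S p hp
    exact ⟨res θ, fun a ha => Subtype.ext (hθ a ha)⟩
  · rintro ⟨b, θ, a, ha⟩
    exact ⟨res θ, a, Subtype.ext ha⟩

end Extension

/-! ### Extending partial isomorphisms without creating new cliques -/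

section Cover

variable {L : FirstOrder.Language.{u, v}} {A V : Type*} [L.Structure A] [L.Structure V]

/-- Some automorphism carries `X` into the range of `i`. -/
def Movable (i : A ↪[L] V) (X : Set V) : Prop :=
  ∃ θ : V ≃[L] V, ∀ x ∈ X, θ x ∈ Set.range i

theorem movable_image_iff (i : A ↪[L] V) (θ : V ≃[L] V) (X : Set V) :
    Movable i (θ '' X) ↔ Movable i X := by
  constructor
  · rintro ⟨α, hα⟩
    exact ⟨α * θ, fun x hx => hα _ ⟨x, hx, rfl⟩⟩
  · rintro ⟨α, hα⟩
    refine ⟨α * θ⁻¹, ?_⟩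
    rintro _ ⟨x, hx, rfl⟩
    change α (θ.symm (θ x)) ∈ _
    rw [θ.symm_apply_apply]
    exact hα x hx

/-- The finite sets that no automorphism carries into the range of `i`. -/
def Unmovable (i : A ↪[L] V) : Type _ := {X : Finset V // ¬ Movable i (X : Set V)}

/-- The action of an automorphism on the unmovable sets. -/
def unmovableEquiv (i : A ↪[L] V) (θ : V ≃[L] V) : Unmovable i ≃ Unmovable i :=
  θ.toEquiv.finsetCongr.subtypeEquiv fun X => by
    rw [Equiv.finsetCongr_apply, Finset.coe_map]
    exact (movable_image_iff i θ X).not.symm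

theorem mem_unmovableEquiv (i : A ↪[L] V) (θ : V ≃[L] V) (X : Unmovable i) (x : V) :
    θ x ∈ (unmovableEquiv i θ X).1 ↔ x ∈ X.1 :=
  Finset.mem_map' θ.toEquiv.toEmbedding

theorem card_unmovableEquiv (i : A ↪[L] V) (θ : V ≃[L] V) (X : Unmovable i) :
    (unmovableEquiv i θ X).1.card = X.1.card :=
  Finset.card_map _

/-- Points of `V` together with a colouring of the unmovable sets, where an unmovable set has one
colour less than it has elements. -/
def Cover (i : A ↪[L] V) : Type _ := V × ∀ X : Unmovable i, Fin (X.1.card - 1)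

/-- Two elements of the cover are compatible when they lie over different points, and are coloured
differently by all the unmovable sets that contain both these points. -/
def Compatible {i : A ↪[L] V} (x y : Cover i) : Prop :=
  x.1 ≠ y.1 ∧ ∀ X : Unmovable i, x.1 ∈ X.1 → y.1 ∈ X.1 → x.2 X ≠ y.2 X

instance (i : A ↪[L] V) [Finite V] : Finite (Cover i) :=
  have : Finite (Unmovable i) := inferInstanceAs (Finite {X : Finset V // ¬ Movable i (X : Set V)})
  inferInstanceAs (Finite (V × ∀ X : Unmovable i, Fin (X.1.card - 1)))

/-- The projection of a set of pairwise compatible elements is movable. -/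
theorem movable_of_compatible [Finite V] {i : A ↪[L] V} (S : Set (Cover i))
    (hS : ∀ x ∈ S, ∀ y ∈ S, x ≠ y → Compatible x y) :
    ∃ θ : V ≃[L] V, ∀ x ∈ S, θ x.1 ∈ Set.range i := by
  classical
  have hfin : S.Finite := Set.toFinite S
  let X : Finset V := hfin.toFinset.image fun x => x.1
  have hX : ∀ x ∈ S, x.1 ∈ X := fun x hx =>
    Finset.mem_image.2 ⟨x, hfin.mem_toFinset.2 hx, rfl⟩
  have hcard : X.card = hfin.toFinset.card := by
    apply Finset.card_image_of_injOn
    intro x hx y hy hxy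
    by_contra hne
    exact (hS x (hfin.mem_toFinset.1 hx) y (hfin.mem_toFinset.1 hy) hne).1 hxy
  by_cases hmov : Movable i (X : Set V)
  · obtain ⟨θ, hθ⟩ := hmov
    exact ⟨θ, fun x hx => hθ _ (hX x hx)⟩
  exfalso
  -- Pigeonhole: were the projection `X` unmovable, the pairwise compatible elements would need
  -- `X.card` distinct colours at `X`, but there are only `X.card - 1`.
  have hle : hfin.toFinset.card ≤ (Finset.univ : Finset (Fin (X.card - 1))).card := by
    refine Finset.card_le_card_of_injOn (fun x => x.2 ⟨X, hmov⟩) (fun _ _ => Finset.mem_univ _) ?_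
    intro x hx y hy hxy
    by_contra hne
    have hx := hfin.mem_toFinset.1 hx
    have hy := hfin.mem_toFinset.1 hy
    exact (hS x hx y hy hne).2 ⟨X, hmov⟩ (hX x hx) (hX y hy) hxy
  have hpos : 0 < X.card := by
    rw [Finset.card_pos]
    by_contra hne
    rw [Finset.not_nonempty_iff_eq_empty] at hne
    exact hmov ⟨1, by simp [hne]⟩
  rw [Finset.card_univ, Fintype.card_fin] at hle
  omega

variable [L.IsRelational]

instance (i : A ↪[L] V) : L.Structure (Cover i) where
  funMap f := isEmptyElim f
  RelMap R t := RelMap R (fun j => (t j).1) ∧ ∀ j k, t j ≠ t k → Compatible (t j) (t k)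

theorem relMap_cover {i : A ↪[L] V} {n : ℕ} (R : L.Relations n) (t : Fin n → Cover i) :
    RelMap R t ↔ RelMap R (fun j => (t j).1) ∧ ∀ j k, t j ≠ t k → Compatible (t j) (t k) :=
  Iff.rfl

/-- An automorphism of `V` lifts to the cover, with prescribed values on pairwise compatible
elements. -/
theorem exists_lift {i : A ↪[L] V} (α : V ≃[L] V) {J : Type*} (s t : J → Cover i)
    (hst : ∀ j, (t j).1 = α (s j).1) (hs : ∀ j k, s j ≠ s k → Compatible (s j) (s k))
    (ht : ∀ j k, t j ≠ t k → Compatible (t j) (t k)) :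
    ∃ θ : Cover i ≃[L] Cover i, ∀ j, θ (s j) = t j := by
  classical
  have hinj : ∀ j k, (s j).1 = (s k).1 → s j = s k ∧ t j = t k := by
    intro j k h
    constructor
    · by_contra hne
      exact (hs j k hne).1 h
    · by_contra hne
      exact (ht j k hne).1 (by rw [hst, hst, h])
  have hcard : ∀ X : Unmovable i, X.1.card - 1 = (unmovableEquiv i α X).1.card - 1 := fun _ => by
    rw [card_unmovableEquiv]
  -- Over `X` the colours of the `s j` must go to those of the `t j`; pairwise compatibility makes
  -- this matching well defined and injective.
  have h1 : ∀ X : Unmovable i,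
      ∃ e : Fin (X.1.card - 1) ≃ Fin ((unmovableEquiv i α X).1.card - 1),
        ∀ j, (s j).1 ∈ X.1 → e ((s j).2 X) = (t j).2 (unmovableEquiv i α X) := by
    intro X
    obtain ⟨e, he⟩ := exists_equiv_comp_eq (finCongr (hcard X))
      (fun j : {j // (s j).1 ∈ X.1} => (s j).2 X)
      (fun j : {j // (s j).1 ∈ X.1} => (t j).2 (unmovableEquiv i α X)) (by
        rintro ⟨j, hj⟩ ⟨k, hk⟩
        constructor
        · intro h
          have : s j = s k := by
            by_contra hne
            exact (hs j k hne).2 X hj hk h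
          change (t j).2 _ = (t k).2 _
          rw [(hinj j k (by rw [this])).2]
        · intro h
          have : t j = t k := by
            by_contra hne
            refine (ht j k hne).2 _ ?_ ?_ h
            · rwa [hst, mem_unmovableEquiv]
            · rwa [hst, mem_unmovableEquiv]
          change (s j).2 _ = (s k).2 _
          rw [(hinj j k (α.injective (by rw [← hst, ← hst, this]))).1])
    exact ⟨e, fun j hj => he ⟨j, hj⟩⟩
  choose e he using h1
  -- Compatibility compares colours at `X` only over points of `X`, so one common bijection is
  -- needed there. Over each other point the bijection is free to be chosen for the prescribed
  -- values alone.
  have h2 : ∀ (x : V) (X : Unmovable i),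
      ∃ E : Fin (X.1.card - 1) ≃ Fin ((unmovableEquiv i α X).1.card - 1),
        (x ∈ X.1 → E = e X) ∧
        ∀ j, (s j).1 = x → E ((s j).2 X) = (t j).2 (unmovableEquiv i α X) := by
    intro x X
    by_cases hx : x ∈ X.1
    · refine ⟨e X, fun _ => rfl, ?_⟩
      rintro j rfl
      exact he X j hx
    · obtain ⟨E, hE⟩ := exists_equiv_comp_eq (finCongr (hcard X))
        (fun j : {j // (s j).1 = x} => (s j).2 X)
        (fun j : {j // (s j).1 = x} => (t j).2 (unmovableEquiv i α X)) (by
          rintro ⟨j, rfl⟩ ⟨k, hk⟩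
          obtain ⟨h, h'⟩ := hinj j k hk.symm
          change (s j).2 X = (s k).2 X ↔ (t j).2 _ = (t k).2 _
          rw [h, h']
          simp)
      exact ⟨E, fun h => absurd h hx, fun j hj => hE ⟨j, hj⟩⟩
  choose E hE hEs using h2
  let θ : Cover i ≃ Cover i :=
    Equiv.prodShear α.toEquiv fun x => Equiv.piCongr (unmovableEquiv i α) (E x)
  have hθ1 : ∀ y, (θ y).1 = α y.1 := fun y => rfl
  have hθ2 : ∀ y X, (θ y).2 (unmovableEquiv i α X) = E y.1 X (y.2 X) := fun y X =>
    Equiv.piCongr_apply_apply (Z := fun X : Unmovable i => Fin (X.1.card - 1)) (unmovableEquiv i α) (E y.1) y.2 X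
  have hθc : ∀ x y, Compatible (θ x) (θ y) ↔ Compatible x y := by
    intro x y
    unfold Compatible
    rw [hθ1, hθ1, α.injective.ne_iff, (unmovableEquiv i α).surjective.forall]
    simp only [mem_unmovableEquiv, hθ2]
    refine and_congr_right fun _ => forall_congr' fun X => forall_congr' fun hx =>
      forall_congr' fun hy => ?_
    rw [hE _ _ hx, hE _ _ hy, (e X).injective.ne_iff]
  refine ⟨equivOfRelMap θ ?_, ?_⟩
  · intro n R x
    rw [relMap_cover, relMap_cover]
    simp only [hθc, hθ1, θ.injective.ne_iff]
    rw [equiv_relMap α R fun j => (x j).1]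
  · intro j
    refine Prod.ext (hst j).symm (funext fun X => ?_)
    obtain ⟨X, rfl⟩ := (unmovableEquiv i α).surjective X
    exact (hθ2 (s j) X).trans (hEs _ X j rfl)

/-- When every point is movable, the given embedding lifts to the cover with pairwise compatible
values. -/
theorem exists_lift_embedding (i : A ↪[L] V) (hV : ∀ x, Movable i {x}) :
    ∃ I : A ↪[L] Cover i, (∀ a, (I a).1 = i a) ∧ ∀ a b, a ≠ b → Compatible (I a) (I b) := by
  classical
  -- As `X` is unmovable, the identity does not carry it into the range of `i`. Hence at most
  -- `X.card - 1` of its points lie in that range, and they can receive distinct colours.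
  have h1 : ∀ X : Unmovable i, ∃ c : V → Fin (X.1.card - 1),
      Set.InjOn c ((X.1 : Set V) ∩ Set.range i) := by
    intro X
    let Y : Finset V := X.1.filter fun x => x ∈ Set.range i
    have hY : (Y : Set V) = (X.1 : Set V) ∩ Set.range i := by ext; simp [Y]
    have hlt : Y.card < X.1.card := by
      apply Finset.card_lt_card
      refine Finset.filter_ssubset.2 ?_
      by_contra! h
      exact X.2 ⟨1, fun x hx => h x hx⟩
    have h2 : 2 ≤ X.1.card := by
      by_contra! h
      rcases Nat.le_one_iff_eq_zero_or_eq_one.1 (Nat.lt_succ_iff.1 h) with h | h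
      · rw [Finset.card_eq_zero] at h
        exact X.2 ⟨1, by simp [h]⟩
      · obtain ⟨x, hx⟩ := Finset.card_eq_one.1 h
        apply X.2
        rw [hx, Finset.coe_singleton]
        exact hV x
    have : Nonempty (Fin (X.1.card - 1)) := ⟨⟨0, by omega⟩⟩
    obtain ⟨f⟩ : Nonempty (Y ↪ Fin (X.1.card - 1)) :=
      Function.Embedding.nonempty_of_card_le (by simp; omega)
    refine ⟨fun x => if h : x ∈ Y then f ⟨x, h⟩ else Classical.arbitrary _, ?_⟩
    rw [← hY]
    intro x hx y hy hxy
    have hx : x ∈ Y := hx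
    have hy : y ∈ Y := hy
    simp only [hx, hy, dif_pos] at hxy
    exact congrArg Subtype.val (f.injective hxy)
  choose c hc using h1
  let I : A → Cover i := fun a => (i a, fun X => c X (i a))
  have hI : ∀ a b, a ≠ b → Compatible (I a) (I b) := fun a b hab =>
    ⟨i.injective.ne hab, fun X ha hb h =>
      i.injective.ne hab (hc X ⟨ha, a, rfl⟩ ⟨hb, b, rfl⟩ h)⟩
  refine ⟨embeddingOfRelMap I (fun a b h => i.injective (congrArg Prod.fst h)) ?_,
    fun a => rfl, hI⟩
  intro n R x
  rw [relMap_cover]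
  refine (and_iff_left fun j k hjk => hI _ _ fun h => hjk (by rw [h])).trans (i.map_rel R x)

variable (L) in
/-- Any two elements of `S` lie in a common related tuple of elements of `S`. -/
def IsClique {B : Type*} [L.Structure B] (S : Set B) : Prop :=
  ∀ x ∈ S, ∀ y ∈ S, x ≠ y → ∃ (n : ℕ) (R : L.Relations n) (t : Fin n → B),
    RelMap R t ∧ (∀ j, t j ∈ S) ∧ x ∈ Set.range t ∧ y ∈ Set.range t

end Cover

/-- Every finite relational structure has a finite extension in which all its partial
isomorphisms extend to automorphisms, and all whose cliques can be moved into it. -/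
theorem exists_faithful_extension {L : FirstOrder.Language.{u, v}} [L.IsRelational]
    [Finite (Σ n, L.Relations n)] (A : Type w) [L.Structure A] [Finite A] :
    ∃ (B : Type (max v w)) (_ : L.Structure B) (_ : Finite B) (i : A ↪[L] B),
      (∀ (S : Set A) (p : A → A), IsPartialIso L S p →
        ∃ θ : B ≃[L] B, ∀ a ∈ S, θ (i a) = i (p a)) ∧
      ∀ S : Set B, IsClique L S → Movable i S := by
  obtain ⟨V, _, _, i, hi, hV⟩ := exists_covered_extension_of_partialIso (L := L) A
  obtain ⟨I, hI, hcomp⟩ := exists_lift_embedding i fun x => by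
    obtain ⟨θ, hθ⟩ := hV x
    exact ⟨θ, by rintro _ rfl; exact hθ⟩
  refine ⟨Cover i, inferInstance, inferInstance, I, ?_, ?_⟩
  · intro S p hp
    obtain ⟨α, hα⟩ := hi S p hp
    obtain ⟨θ, hθ⟩ := exists_lift α (fun a : S => I a) (fun a : S => I (p a))
      (fun a => by rw [hI, hI, hα a a.2]) (fun a b h => hcomp _ _ fun hab => h (by rw [hab]))
      (fun a b h => hcomp _ _ fun hab => h (by rw [hab]))
    exact ⟨θ, fun a ha => hθ ⟨a, ha⟩⟩
  · intro S hS
    -- Distinct entries of a related tuple of the cover are compatible by definition, so a clique is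
    -- pairwise compatible.
    have hSc : ∀ x ∈ S, ∀ y ∈ S, x ≠ y → Compatible x y := by
      intro x hx y hy hxy
      obtain ⟨n, R, t, hR, -, ⟨j, rfl⟩, ⟨k, rfl⟩⟩ := hS x hx y hy hxy
      exact hR.2 j k hxy
    obtain ⟨α, hα⟩ := movable_of_compatible S hSc
    choose a ha using fun x : S => hα x x.2
    obtain ⟨θ, hθ⟩ := exists_lift α (fun x : S => (x : Cover i)) (fun x => I (a x))
      (fun x => by rw [hI, ha]) (fun x y h => hSc x x.2 y y.2 h)
      (fun x y h => hcomp _ _ fun hab => h (by rw [hab]))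
    exact ⟨θ, fun x hx => ⟨a ⟨x, hx⟩, (hθ ⟨x, hx⟩).symm⟩⟩

/-! ### Finite configurations in a free homogeneous structure -/

section SmallCopy

variable {L : FirstOrder.Language.{u, v}} {C : Type*}

/-- A copy in `Type w` of a subset of a structure. -/
def SmallCopy (X : Set C) [Small.{w} X] : Type w := Shrink.{w} X

variable {X Y : Set C} [Small.{w} X] [Small.{w} Y]

/-- The point that an element of a copy stands for. -/
noncomputable def SmallCopy.val (x : SmallCopy.{w} X) : C := ((equivShrink X).symm x : X)

/-- The element of the copy that stands for a given point. -/
noncomputable def SmallCopy.mk (c : C) (hc : c ∈ X) : SmallCopy.{w} X := equivShrink X ⟨c, hc⟩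

theorem SmallCopy.val_mem (x : SmallCopy.{w} X) : x.val ∈ X := Subtype.prop _

@[simp]
theorem SmallCopy.val_mk (c : C) (hc : c ∈ X) : (SmallCopy.mk.{w} c hc).val = c := by
  simp [SmallCopy.mk, SmallCopy.val]

theorem SmallCopy.val_injective : Function.Injective (SmallCopy.val : SmallCopy.{w} X → C) :=
  Subtype.val_injective.comp (equivShrink X).symm.injective

instance [Finite X] : Finite (SmallCopy.{w} X) := inferInstanceAs (Finite (Shrink.{w} X))

variable [L.IsRelational] [L.Structure C]

instance : L.Structure (SmallCopy.{w} X) where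
  funMap f := isEmptyElim f
  RelMap R x := RelMap R fun i => (x i).val

theorem SmallCopy.relMap_iff {n : ℕ} (R : L.Relations n) (x : Fin n → SmallCopy.{w} X) :
    RelMap R x ↔ RelMap R fun i => (x i).val := Iff.rfl

variable (L) in
/-- The embedding of copies induced by an inclusion. -/
noncomputable def SmallCopy.incl (h : X ⊆ Y) : SmallCopy.{w} X ↪[L] SmallCopy.{w} Y :=
  embeddingOfRelMap (fun x => SmallCopy.mk x.val (h x.val_mem))
    (fun x y hxy => SmallCopy.val_injective (by simpa using congrArg SmallCopy.val hxy))
    fun n R x => by simp only [SmallCopy.relMap_iff, SmallCopy.val_mk]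

@[simp]
theorem SmallCopy.val_incl (h : X ⊆ Y) (x : SmallCopy.{w} X) :
    (SmallCopy.incl L h x).val = x.val :=
  SmallCopy.val_mk _ _

variable {M : Type w} [L.Structure M]

/-- The age of `M` consists of structures in `Type w`, while the finite extensions live in a larger
universe; copies bring their finite subsets into the age. -/
theorem SmallCopy.mem_age [Finite X] {f : C → M} (hf : IsPartialIso L X f) :
    ⟨SmallCopy.{w} X, inferInstance⟩ ∈ L.age M := by
  have : Finite (⟨SmallCopy.{w} X, inferInstance⟩ :
      CategoryTheory.Bundled.{w} L.Structure) := inferInstanceAs (Finite (SmallCopy.{w} X))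
  refine ⟨FirstOrder.Language.Structure.FG.of_finite, ⟨embeddingOfRelMap (fun x => f x.val) ?_ ?_⟩⟩
  · intro x y hxy
    exact SmallCopy.val_injective (hf.1 x.val_mem y.val_mem hxy)
  · intro n R x
    exact hf.2 R (fun i => (x i).val) fun i => (x i).val_mem

theorem SmallCopy.exists_isPartialIso [Nonempty M] (j : SmallCopy.{w} X ↪[L] M) :
    ∃ f : C → M, IsPartialIso L X f := by
  classical
  let f : C → M := fun c =>
    if h : c ∈ X then j (SmallCopy.mk c h) else Classical.arbitrary M
  have hf : ∀ c (h : c ∈ X), f c = j (SmallCopy.mk c h) := fun c h => dif_pos h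
  refine ⟨f, ?_, ?_⟩
  · intro a ha b hb hab
    rw [hf a ha, hf b hb] at hab
    simpa using congrArg SmallCopy.val (j.injective hab)
  · intro n R x hx
    simp only [hf _ (hx _)]
    rw [embedding_relMap j R fun i => SmallCopy.mk (x i) (hx i), SmallCopy.relMap_iff]
    simp only [SmallCopy.val_mk]

end SmallCopy

/-! ### Homogeneity, free amalgamation and finite invariant sets in `M` -/

section Homogeneous

variable {L : FirstOrder.Language.{u, v}} [L.IsRelational] {M : Type w} [L.Structure M]

theorem exists_equiv_of_isPartialIso (hU : L.IsUltrahomogeneous M) {S : Set M} (hS : S.Finite)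
    {f : M → M} (hf : IsPartialIso L S f) : ∃ g : M ≃[L] M, ∀ x ∈ S, g x = f x := by
  have hmem : ∀ x, x ∈ FirstOrder.Language.Substructure.closure L S ↔ x ∈ S :=
    FirstOrder.Language.Substructure.mem_closure_iff_of_isRelational L S
  obtain ⟨g, hg⟩ := hU (FirstOrder.Language.Substructure.closure L S)
    (FirstOrder.Language.Substructure.fg_closure hS)
    (embeddingOfRelMap (fun x => f x)
      (fun x y hxy => Subtype.ext (hf.1 ((hmem x).1 x.2) ((hmem y).1 y.2) hxy))
      fun n R x => hf.2 R (fun i => (x i : M)) fun i => (hmem _).1 (x i).2)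
  refine ⟨g, fun x hx => ?_⟩
  exact (DFunLike.congr_fun hg ⟨x, (hmem x).2 hx⟩).symm

/-- The free amalgamation property for finite subsets of a structure. -/
theorem exists_isPartialIso_union [Nonempty M] (hfree : FreeAmalgamation (L.age M)) {C : Type*}
    [L.Structure C] {D E : Set C} (hDfin : D.Finite) (hEfin : E.Finite)
    (hrel : ∀ ⦃n : ℕ⦄ (R : L.Relations n) (x : Fin n → C), RelMap R x → (∀ i, x i ∈ D ∪ E) →
      (∀ i, x i ∈ D) ∨ ∀ i, x i ∈ E)
    (hD : ∃ f : C → M, IsPartialIso L D f) (hE : ∃ f : C → M, IsPartialIso L E f) :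
    ∃ f : C → M, IsPartialIso L (D ∪ E) f := by
  obtain ⟨f, hf⟩ := hD
  obtain ⟨g, hg⟩ := hE
  have := hDfin.to_subtype
  have := hEfin.to_subtype
  have := (hDfin.union hEfin).to_subtype
  have := (hDfin.inter_of_left E).to_subtype
  have hmem := hfree ⟨SmallCopy.{w} (D ∩ E : Set C), inferInstance⟩
    ⟨SmallCopy.{w} D, inferInstance⟩ ⟨SmallCopy.{w} E, inferInstance⟩
    ⟨SmallCopy.{w} (D ∪ E : Set C), inferInstance⟩
    (SmallCopy.incl L Set.inter_subset_left) (SmallCopy.incl L Set.inter_subset_right)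
    (SmallCopy.incl L Set.subset_union_left) (SmallCopy.incl L Set.subset_union_right)
    (SmallCopy.mem_age (hf.mono Set.inter_subset_left)) (SmallCopy.mem_age hf)
    (SmallCopy.mem_age hg) ?_
  · obtain ⟨-, ⟨j⟩⟩ := hmem
    exact SmallCopy.exists_isPartialIso j
  refine ⟨fun a => ?_, ?_, ?_, ?_⟩
  · exact SmallCopy.val_injective (by simp)
  · rw [Set.eq_univ_iff_forall]
    intro c
    rcases c.val_mem with h | h
    · exact Or.inl ⟨SmallCopy.mk c.val h, SmallCopy.val_injective (by simp)⟩
    · exact Or.inr ⟨SmallCopy.mk c.val h, SmallCopy.val_injective (by simp)⟩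
  · ext c
    constructor
    · rintro ⟨⟨x, rfl⟩, y, hy⟩
      have hxy : y.val = x.val := by simpa using congrArg SmallCopy.val hy
      exact ⟨SmallCopy.mk x.val ⟨x.val_mem, hxy ▸ y.val_mem⟩,
        SmallCopy.val_injective (by
          simp only [SmallCopy.val_incl]
          exact SmallCopy.val_mk.{w} (X := D ∩ E) _ _)⟩
    · rintro ⟨a, rfl⟩
      exact ⟨⟨_, rfl⟩, SmallCopy.incl L Set.inter_subset_right a,
        SmallCopy.val_injective (by simp)⟩
  · intro n R x
    constructor
    · intro hx
      rcases hrel R (fun i => (x i).val) hx fun i => (x i).val_mem with h | h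
      · refine Or.inl ⟨fun i => SmallCopy.mk (x i).val (h i), ?_, ?_⟩
        · rw [SmallCopy.relMap_iff]
          simp only [SmallCopy.val_mk]
          exact hx
        · exact funext fun i => SmallCopy.val_injective (by simp)
      · refine Or.inr ⟨fun i => SmallCopy.mk (x i).val (h i), ?_, ?_⟩
        · rw [SmallCopy.relMap_iff]
          simp only [SmallCopy.val_mk]
          exact hx
        · exact funext fun i => SmallCopy.val_injective (by simp)
    · rintro (⟨y, hy, rfl⟩ | ⟨y, hy, rfl⟩)
      · exact (embedding_relMap _ R y).2 hy
      · exact (embedding_relMap _ R y).2 hy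

/-- If all cliques of a finite structure embed into `M`, then so does the structure. -/
theorem exists_isPartialIso_of_isClique [Nonempty M] (hfree : FreeAmalgamation (L.age M))
    {C : Type*} [L.Structure C] (hcl : ∀ S : Set C, IsClique L S → ∃ f : C → M, IsPartialIso L S f)
    (S : Finset C) : ∃ f : C → M, IsPartialIso L (S : Set C) f := by
  classical
  induction S using Finset.strongInduction with
  | H S ih =>
    by_cases hS : IsClique L (S : Set C)
    · exact hcl _ hS
    unfold IsClique at hS
    push Not at hS
    obtain ⟨x, hx, y, hy, hxy, h⟩ := hS
    -- As `x` and `y` lie in no common related tuple of `S`, the set `S` is the free amalgam of `S \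
    -- {x}` and `S \ {y}`.
    have hunion : (S : Set C) = ((S.erase x : Finset C) : Set C) ∪ ((S.erase y : Finset C) : Set C) := by
      ext z
      simp only [Finset.coe_erase, Set.mem_union, Set.mem_sdiff, Set.mem_singleton_iff]
      constructor
      · intro hz
        by_cases hzx : z = x
        · exact Or.inr ⟨hz, fun hzy => hxy (hzx.symm.trans hzy)⟩
        · exact Or.inl ⟨hz, hzx⟩
      · rintro (h | h) <;> exact h.1
    rw [hunion]
    refine exists_isPartialIso_union hfree (Finset.finite_toSet _) (Finset.finite_toSet _) ?_
      (ih _ (Finset.erase_ssubset hx)) (ih _ (Finset.erase_ssubset hy))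
    intro n R t hR ht
    rw [← hunion] at ht
    by_cases hxt : x ∈ Set.range t
    · right
      intro i
      refine Finset.mem_coe.2 (Finset.mem_erase.2 ⟨fun hi => ?_, ht i⟩)
      exact h n R t hR ht hxt ⟨i, hi⟩
    · left
      intro i
      exact Finset.mem_coe.2 (Finset.mem_erase.2 ⟨fun hi => hxt ⟨i, hi⟩, ht i⟩)

/-- Automorphisms can be changed outside a finite set in such a way that this set is contained
in a finite invariant set. -/
theorem exists_finite_invariant [Nonempty M] [Finite (Σ n, L.Relations n)]
    (hU : L.IsUltrahomogeneous M)
    (hfree : FreeAmalgamation (L.age M)) {ι : Type*} [Finite ι] (h : ι → (M ≃[L] M))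
    (F : Finset M) : ∃ (k : ι → (M ≃[L] M)) (D : Finset M),
      F ⊆ D ∧ (∀ i, ∀ x ∈ F, k i x = h i x) ∧ ∀ i x, k i x ∈ D ↔ x ∈ D := by
  classical
  have := Fintype.ofFinite ι
  let A : Finset M := F ∪ Finset.univ.biUnion fun i => F.image (h i)
  have hFA : F ⊆ A := Finset.subset_union_left
  have hhA : ∀ i, ∀ x ∈ F, h i x ∈ A := fun i x hx =>
    Finset.mem_union_right _ (Finset.mem_biUnion.2 ⟨i, Finset.mem_univ _,
      Finset.mem_image_of_mem _ hx⟩)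
  let A' : L.Substructure M :=
    { carrier := (A : Set M)
      fun_mem := fun f => isEmptyElim f }
  have : Finite A' := A.finite_toSet.to_subtype
  obtain ⟨B, _, _, e, he, hcl⟩ := exists_faithful_extension (L := L) A'
  have := Fintype.ofFinite B
  obtain ⟨j, hj⟩ := exists_isPartialIso_of_isClique hfree (C := B) (M := M) (by
    intro S hS
    obtain ⟨θ, hθ⟩ := hcl S hS
    let r : B → M := Function.extend e (fun a : A' => (a : M)) fun _ => Classical.arbitrary M
    have hr : ∀ a, r (e a) = a := fun a => e.injective.extend_apply _ _ a
    have hr' : IsPartialIso L (Set.range e) r := by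
      constructor
      · rintro _ ⟨a, rfl⟩ _ ⟨b, rfl⟩ hab
        rw [hr, hr] at hab
        rw [Subtype.ext hab]
      · intro n R x hx
        choose a ha using hx
        obtain rfl : (fun i => e (a i)) = x := funext ha
        simp only [hr]
        rw [embedding_relMap e R a]
        rfl
    exact ⟨_, hr'.comp (isPartialIso_equiv θ S) hθ⟩) Finset.univ
  rw [Finset.coe_univ] at hj
  -- The embedding of `B` need not be the identity on `A`; homogeneity provides an automorphism that
  -- corrects this.
  obtain ⟨g, hg⟩ : ∃ g : M ≃[L] M, ∀ a : A', g a = j (e a) := by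
    let s : M → M := fun x => if hx : x ∈ A' then j (e ⟨x, hx⟩) else x
    have hs : ∀ a : A', s a = j (e a) := fun a => dif_pos a.2
    have hje : IsPartialIso L Set.univ fun a : A' => j (e a) :=
      hj.comp (isPartialIso_embedding e _) fun _ _ => Set.mem_univ _
    obtain ⟨g, hg⟩ := exists_equiv_of_isPartialIso hU (S := (A : Set M)) (f := s) A.finite_toSet (by
      constructor
      · intro x hx y hy hxy
        have hxy : s (⟨x, hx⟩ : A') = s (⟨y, hy⟩ : A') := hxy
        rw [hs, hs] at hxy
        exact congrArg Subtype.val (hje.1 (Set.mem_univ _) (Set.mem_univ _) hxy)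
      · intro n R x hx
        have : (fun i => s (x i)) = fun i => j (e ⟨x i, hx i⟩) := funext fun i => hs ⟨x i, hx i⟩
        rw [this]
        exact hje.2 R (fun i => (⟨x i, hx i⟩ : A')) fun _ => Set.mem_univ _)
    exact ⟨g, fun a => (hg a a.2).trans (hs a)⟩
  let J : B → M := fun b => g.symm (j b)
  have hJ : IsPartialIso L Set.univ J :=
    (isPartialIso_equiv g.symm Set.univ).comp hj fun _ _ => Set.mem_univ _
  have hJe : ∀ a : A', J (e a) = a := fun a => by
    change g.symm (j (e a)) = a
    rw [← hg, g.symm_apply_apply]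
  have hJinj : Function.Injective J := fun a b hab => hJ.1 (Set.mem_univ _) (Set.mem_univ _) hab
  have hθ : ∀ i, ∃ θ : B ≃[L] B, ∀ x (hx : x ∈ F),
      θ (e ⟨x, hFA hx⟩) = e ⟨h i x, hhA i x hx⟩ := by
    intro i
    let p : A' → A' := fun a => if ha : h i a ∈ A' then ⟨h i a, ha⟩ else a
    have hp : ∀ a : A', (a : M) ∈ F → (p a : M) = h i a := fun a ha => by
      have : h i a ∈ A' := hhA i a ha
      simp only [p, this, dif_pos]
    obtain ⟨θ, hθ⟩ := he {a | (a : M) ∈ F} p (by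
      constructor
      · intro a ha b hb hab
        refine Subtype.ext ((h i).injective ?_)
        rw [← hp a ha, ← hp b hb, hab]
      · intro n R x hx
        have : (fun k => (p (x k) : M)) = fun k => h i (x k) := funext fun k => hp _ (hx k)
        change RelMap R (fun k => (p (x k) : M)) ↔ RelMap R fun k => (x k : M)
        rw [this]
        exact equiv_relMap (h i) R _)
    refine ⟨θ, fun x hx => (hθ ⟨x, hFA hx⟩ hx).trans ?_⟩
    exact congrArg e (Subtype.ext (hp ⟨x, hFA hx⟩ hx))
  choose θ hθ using hθ
  have hk : ∀ i, ∃ k : M ≃[L] M, ∀ b, k (J b) = J (θ i b) := by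
    intro i
    let q : M → M := Function.extend J (fun b => J (θ i b)) id
    have hq : ∀ b, q (J b) = J (θ i b) := fun b => hJinj.extend_apply _ _ b
    obtain ⟨k, hk⟩ := exists_equiv_of_isPartialIso hU (S := Set.range J) (f := q)
      (Set.finite_range J) (by
        constructor
        · rintro _ ⟨a, rfl⟩ _ ⟨b, rfl⟩ hab
          rw [hq, hq] at hab
          rw [(θ i).injective (hJinj hab)]
        · intro n R x hx
          choose b hb using hx
          obtain rfl : (fun i => J (b i)) = x := funext hb
          simp only [hq]
          rw [hJ.2 R (fun k => θ i (b k)) fun _ => Set.mem_univ _,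
            hJ.2 R b fun _ => Set.mem_univ _, equiv_relMap])
    exact ⟨k, fun b => (hk _ ⟨b, rfl⟩).trans (hq b)⟩
  choose k hk using hk
  have hJF : ∀ a (ha : a ∈ A), J (e ⟨a, ha⟩) = a := fun a ha => hJe ⟨a, ha⟩
  refine ⟨k, Finset.univ.image J, ?_, ?_, ?_⟩
  · intro x hx
    exact Finset.mem_image.2 ⟨e ⟨x, hFA hx⟩, Finset.mem_univ _, hJF x _⟩
  · intro i x hx
    have := hk i (e ⟨x, hFA hx⟩)
    rwa [hθ i x hx, hJF, hJF] at this
  · intro i x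
    simp only [Finset.mem_image, Finset.mem_univ, true_and]
    constructor
    · rintro ⟨b, hb⟩
      obtain ⟨b, rfl⟩ := (θ i).surjective b
      exact ⟨b, (k i).injective (by rw [hk, hb])⟩
    · rintro ⟨b, rfl⟩
      exact ⟨θ i b, (hk i b).symm⟩

/-- A finite set can be moved over a subset `A` to be free from another finite set over `A`. -/
theorem exists_free_position [Nonempty M] (hU : L.IsUltrahomogeneous M)
    (hfree : FreeAmalgamation (L.age M)) {A C D : Finset M} (hAC : A ⊆ C) (hAD : A ⊆ D) :
    ∃ g : M ≃[L] M, (∀ a ∈ A, g a = a) ∧ (∀ c ∈ C, g c ∈ D → c ∈ A) ∧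
      ∀ ⦃n : ℕ⦄ (R : L.Relations n) (x : Fin n → M), RelMap R x →
        (∀ i, x i ∈ D ∨ ∃ c ∈ C, g c = x i) → (∀ i, x i ∈ D) ∨ ∀ i, ∃ c ∈ C, g c = x i := by
  classical
  -- The free amalgam of `D` and `C` over `A` is modelled in `M ⊕ M`: `D` sits on the left, and `p`
  -- places `C` on the right except for `A`, which is shared. The map `r` folds both sides back to
  -- `M`.
  let p : M → M ⊕ M := fun c => if c ∈ A then Sum.inl c else Sum.inr c
  let r : M ⊕ M → M := Sum.elim id id
  have hrp : ∀ c, r (p c) = c := fun c => by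
    by_cases hc : c ∈ A <;> simp [p, r, hc]
  have hpA : ∀ a ∈ A, p a = Sum.inl a := fun a ha => if_pos ha
  have hpl : ∀ c d, p c = Sum.inl d → c ∈ A ∧ c = d := by
    intro c d hcd
    by_cases hc : c ∈ A
    · rw [hpA c hc] at hcd
      exact ⟨hc, Sum.inl_injective hcd⟩
    · simp [p, hc] at hcd
  let _ : L.Structure (M ⊕ M) :=
    { funMap := fun f => isEmptyElim f
      RelMap := fun {n} R x =>
        (∃ y : Fin n → M, (∀ i, y i ∈ D) ∧ RelMap R y ∧ x = fun i => Sum.inl (y i)) ∨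
        ∃ y : Fin n → M, (∀ i, y i ∈ C) ∧ RelMap R y ∧ x = fun i => p (y i) }
  have hdef : ∀ {n : ℕ} (R : L.Relations n) (x : Fin n → M ⊕ M), RelMap R x ↔
      (∃ y : Fin n → M, (∀ i, y i ∈ D) ∧ RelMap R y ∧ x = fun i => Sum.inl (y i)) ∨
      ∃ y : Fin n → M, (∀ i, y i ∈ C) ∧ RelMap R y ∧ x = fun i => p (y i) :=
    fun R x => Iff.rfl
  have hr : ∀ {n : ℕ} (R : L.Relations n) (x : Fin n → M ⊕ M), RelMap R x →
      RelMap R fun i => r (x i) := by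
    intro n R x hx
    rcases (hdef R x).1 hx with ⟨y, -, hy, rfl⟩ | ⟨y, -, hy, rfl⟩
    · exact hy
    · simpa only [hrp] using hy
  have hl : IsPartialIso L (D : Set M) (Sum.inl : M → M ⊕ M) :=
    ⟨Sum.inl_injective.injOn, fun n R x hx =>
      ⟨fun h => hr R _ h, fun h => (hdef R _).2 (Or.inl ⟨x, hx, h, rfl⟩)⟩⟩
  have hp : IsPartialIso L (C : Set M) p :=
    ⟨(Function.LeftInverse.injective hrp).injOn, fun n R x hx =>
      ⟨fun h => by simpa only [hrp] using hr R _ h,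
        fun h => (hdef R _).2 (Or.inr ⟨x, hx, h, rfl⟩)⟩⟩
  obtain ⟨f, hf⟩ := exists_isPartialIso_union hfree (C := M ⊕ M) (M := M)
    (D := Sum.inl '' (D : Set M)) (E := p '' (C : Set M)) (D.finite_toSet.image _)
    (C.finite_toSet.image _) (by
      intro n R x hx _
      rcases (hdef R x).1 hx with ⟨y, hyD, -, rfl⟩ | ⟨y, hyC, -, rfl⟩
      · exact Or.inl fun i => ⟨y i, hyD i, rfl⟩
      · exact Or.inr fun i => ⟨y i, hyC i, rfl⟩)
    ⟨r, by
      constructor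
      · rintro _ ⟨a, -, rfl⟩ _ ⟨b, -, rfl⟩ hab
        exact congrArg Sum.inl hab
      · intro n R x hx
        choose y hy hyx using hx
        obtain rfl : (fun i => Sum.inl (y i)) = x := funext hyx
        exact (hl.2 R y hy).symm⟩
    ⟨r, by
      constructor
      · rintro _ ⟨a, -, rfl⟩ _ ⟨b, -, rfl⟩ hab
        rw [hrp, hrp] at hab
        rw [hab]
      · intro n R x hx
        choose y hy hyx using hx
        obtain rfl : (fun i => p (y i)) = x := funext hyx
        simp only [hrp]
        exact (hp.2 R y hy).symm⟩
  obtain ⟨g₁, hg₁⟩ := exists_equiv_of_isPartialIso hU D.finite_toSet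
    (hf.comp hl fun d hd => Or.inl ⟨d, hd, rfl⟩)
  obtain ⟨g₂, hg₂⟩ := exists_equiv_of_isPartialIso hU C.finite_toSet
    (hf.comp hp fun c hc => Or.inr ⟨c, hc, rfl⟩)
  have happ : ∀ x y, (g₁⁻¹ * g₂) x = y ↔ g₂ x = g₁ y := by
    intro x y
    change g₁.symm (g₂ x) = y ↔ _
    constructor
    · rintro rfl
      rw [g₁.apply_symm_apply]
    · intro h
      rw [h, g₁.symm_apply_apply]
  refine ⟨g₁⁻¹ * g₂, ?_, ?_, ?_⟩
  · intro a ha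
    rw [happ, hg₂ a (hAC ha), hg₁ a (hAD ha), hpA a ha]
  · intro c hc hd
    have h := (happ c _).1 rfl
    rw [hg₂ c hc, hg₁ _ hd] at h
    exact (hpl _ _ (hf.1 (Or.inr ⟨c, hc, rfl⟩) (Or.inl ⟨_, hd, rfl⟩) h)).1
  · intro n R x hR hx
    have hz : ∀ i, ∃ z : M ⊕ M, f z = g₁ (x i) ∧ z ∈ Sum.inl '' (D : Set M) ∪ p '' (C : Set M) ∧
        (∀ d, z = Sum.inl d → d ∈ D → x i ∈ D) ∧
        ∀ c ∈ C, z = p c → (g₁⁻¹ * g₂) c = x i := by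
      intro i
      have key : ∀ z : M ⊕ M, f z = g₁ (x i) →
          z ∈ Sum.inl '' (D : Set M) ∪ p '' (C : Set M) →
          (∀ d, z = Sum.inl d → d ∈ D → x i ∈ D) ∧ ∀ c ∈ C, z = p c → (g₁⁻¹ * g₂) c = x i := by
        intro z hz _
        constructor
        · rintro d rfl hd
          rw [← hg₁ d hd] at hz
          rwa [← g₁.injective hz]
        · rintro c hc rfl
          rw [happ, hg₂ c hc, hz]
      rcases hx i with hd | ⟨c, hc, hcx⟩
      · have h1 : f (Sum.inl (x i)) = g₁ (x i) := (hg₁ _ hd).symm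
        have h2 : (Sum.inl (x i) : M ⊕ M) ∈ Sum.inl '' (D : Set M) ∪ p '' (C : Set M) :=
          Or.inl ⟨_, hd, rfl⟩
        exact ⟨_, h1, h2, key _ h1 h2⟩
      · have h1 : f (p c) = g₁ (x i) := by rw [← (happ _ _).1 hcx, hg₂ c hc]
        have h2 : p c ∈ Sum.inl '' (D : Set M) ∪ p '' (C : Set M) := Or.inr ⟨_, hc, rfl⟩
        exact ⟨_, h1, h2, key _ h1 h2⟩
    choose z hz hzmem hzD hzC using hz
    have hRz : RelMap R z := by
      rw [← hf.2 R z hzmem]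
      simp only [hz]
      rwa [equiv_relMap]
    rcases (hdef R z).1 hRz with ⟨y, hyD, -, hzy⟩ | ⟨y, hyC, -, hzy⟩
    · exact Or.inl fun i => hzD i (y i) (congrFun hzy i) (hyD i)
    · exact Or.inr fun i => ⟨y i, hyC i, hzC i (y i) (hyC i) (congrFun hzy i)⟩

/-- Two automorphisms that agree on an invariant set `A`, and are considered on finite invariant
sets `D` and `C` containing `A`, are jointly realised up to conjugation over `A`. -/
theorem exists_joint_realisation [Nonempty M] (hU : L.IsUltrahomogeneous M)
    (hfree : FreeAmalgamation (L.age M)) {ι : Type*} {A C D : Finset M} (hAC : A ⊆ C)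
    (hAD : A ⊆ D) (h k : ι → (M ≃[L] M)) (hA : ∀ i x, h i x ∈ A ↔ x ∈ A)
    (hD : ∀ i x, h i x ∈ D ↔ x ∈ D) (hC : ∀ i x, k i x ∈ C ↔ x ∈ C)
    (hk : ∀ i, ∀ a ∈ A, h i a = k i a) :
    ∃ (l : ι → (M ≃[L] M)) (g : M ≃[L] M), (∀ i, ∀ d ∈ D, l i d = h i d) ∧ (∀ a ∈ A, g a = a) ∧
      ∀ i, ∀ c ∈ C, l i (g c) = g (k i c) := by
  classical
  obtain ⟨g, hgA, hgC, hrel⟩ := exists_free_position hU hfree hAC hAD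
  have hl : ∀ i, ∃ l : M ≃[L] M, (∀ d ∈ D, l d = h i d) ∧ ∀ c ∈ C, l (g c) = g (k i c) := by
    intro i
    -- The union of `h i` on `D` and the conjugate of `k i` by `g` on the image of `C`; the two
    -- agree on the overlap `A`.
    let q : M → M := fun x => if x ∈ D then h i x else g (k i (g.symm x))
    have hqD : ∀ d ∈ D, q d = h i d := fun d hd => if_pos hd
    have hqC : ∀ c ∈ C, q (g c) = g (k i c) := by
      intro c hc
      by_cases hd : g c ∈ D
      · have hcA := hgC c hc hd
        rw [hqD _ hd, hgA c hcA, hk i c hcA, hgA]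
        rw [← hk i c hcA]
        exact (hA i c).2 hcA
      · exact (if_neg hd).trans (by rw [g.symm_apply_apply])
    -- A point whose image lies in one of the two pieces lies in that piece itself, by invariance of
    -- `A`, `C` and `D`. This gives injectivity across the pieces and the reflection of relations.
    have hqmem : ∀ x, (x ∈ D ∨ ∃ c ∈ C, g c = x) → (q x ∈ D → x ∈ D) ∧
        ((∃ c ∈ C, g c = q x) → ∃ c ∈ C, g c = x) := by
      rintro x (hx | ⟨c, hc, rfl⟩)
      · refine ⟨fun _ => hx, ?_⟩
        rintro ⟨c, hc, hcx⟩
        rw [hqD x hx] at hcx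
        have hcA : c ∈ A := hgC c hc (by rw [hcx, hD]; exact hx)
        rw [hgA c hcA] at hcx
        rw [hcx, hA] at hcA
        exact ⟨x, hAC hcA, hgA x hcA⟩
      · refine ⟨fun hd => ?_, fun _ => ⟨c, hc, rfl⟩⟩
        rw [hqC c hc] at hd
        have hkA : k i c ∈ A := hgC _ ((hC i c).2 hc) hd
        obtain ⟨a, ha⟩ := (h i).surjective (k i c)
        have haA : a ∈ A := by rw [← hA i, ha]; exact hkA
        have : a = c := (k i).injective (by rw [← hk i a haA, ha])
        rw [← this, hgA a haA]
        exact hAD haA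
    have hCinj : ∀ c ∈ C, ∀ c' ∈ C, q (g c) = q (g c') → g c = g c' := by
      intro c hc c' hc' hcc
      rw [hqC c hc, hqC c' hc'] at hcc
      rw [(k i).injective (g.injective hcc)]
    have hDinj : ∀ d ∈ D, ∀ d' ∈ D, q d = q d' → d = d' := by
      intro d hd d' hd' hdd
      rw [hqD d hd, hqD d' hd'] at hdd
      exact (h i).injective hdd
    have hq : IsPartialIso L {x | x ∈ D ∨ ∃ c ∈ C, g c = x} q := by
      constructor
      · intro x hx y hy hxy
        rcases hx with hx | ⟨c, hc, rfl⟩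
        · have hyD : y ∈ D := (hqmem y hy).1 (by rw [← hxy, hqD x hx, hD]; exact hx)
          exact hDinj x hx y hyD hxy
        · obtain ⟨c', hc', rfl⟩ := (hqmem y hy).2
            ⟨k i c, (hC i c).2 hc, by rw [← hxy, hqC c hc]⟩
          exact hCinj c hc c' hc' hxy
      · intro n R x hx
        have hD' : (∀ j, x j ∈ D) → (RelMap R (fun j => q (x j)) ↔ RelMap R x) := by
          intro hxD
          simp only [hqD _ (hxD _)]
          exact equiv_relMap (h i) R x
        have hC' : (∀ j, ∃ c ∈ C, g c = x j) → (RelMap R (fun j => q (x j)) ↔ RelMap R x) := by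
          intro hxC
          choose c hc hcx using hxC
          obtain rfl : (fun j => g (c j)) = x := funext hcx
          simp only [hqC _ (hc _)]
          rw [equiv_relMap g R fun j => k i (c j), equiv_relMap (k i) R c, equiv_relMap g R c]
        constructor
        · intro hR
          rcases hrel R _ hR fun j => (hx j).imp (fun hd => by rw [hqD _ hd, hD]; exact hd) (by
              rintro ⟨c, hc, hcx⟩
              exact ⟨k i c, (hC i c).2 hc, by rw [← hcx, hqC c hc]⟩) with h | h
          · exact (hD' fun j => (hqmem _ (hx j)).1 (h j)).1 hR
          · exact (hC' fun j => (hqmem _ (hx j)).2 (h j)).1 hR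
        · intro hR
          rcases hrel R _ hR hx with h | h
          · exact (hD' h).2 hR
          · exact (hC' h).2 hR
    have hfin : {x | x ∈ D ∨ ∃ c ∈ C, g c = x}.Finite :=
      D.finite_toSet.union (C.finite_toSet.image g)
    obtain ⟨l, hl⟩ := exists_equiv_of_isPartialIso hU hfin hq
    exact ⟨l, fun d hd => (hl d (Or.inl hd)).trans (hqD d hd),
      fun c hc => (hl _ (Or.inr ⟨c, hc, rfl⟩)).trans (hqC c hc)⟩
  choose l hlD hlC using hl
  exact ⟨l, g, hlD, hgA, hlC⟩

end Homogeneous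

/-! ### The automorphism group as a Polish group -/

section Topology

variable {L : FirstOrder.Language.{u, v}} {M : Type w} [L.Structure M]

theorem aut_mul_apply (g h : M ≃[L] M) (x : M) : (g * h) x = g (h x) := rfl

theorem aut_inv_apply_eq (g : M ≃[L] M) {x y : M} : g⁻¹ x = y ↔ g y = x := by
  change g.symm x = y ↔ _
  constructor
  · rintro rfl
    exact g.apply_symm_apply x
  · rintro rfl
    exact g.symm_apply_apply y

@[simp]
theorem aut_inv_apply_apply (g : M ≃[L] M) (x : M) : g⁻¹ (g x) = x := g.symm_apply_apply x

@[simp]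
theorem aut_apply_inv_apply (g : M ≃[L] M) (x : M) : g (g⁻¹ x) = x := g.apply_symm_apply x

theorem isOpen_setOf_apply_eq (x y : M) : IsOpen {g : M ≃[L] M | g x = y} := by
  let _ : TopologicalSpace M := ⊥
  have : DiscreteTopology M := ⟨rfl⟩
  have h : Continuous fun g : M ≃[L] M => (g : M → M) := continuous_induced_dom
  exact (isOpen_discrete {y}).preimage ((continuous_apply x).comp h)

theorem continuous_of_isOpen_setOf_apply_eq {X : Type*} [TopologicalSpace X] {f : X → (M ≃[L] M)}
    (hf : ∀ x y, IsOpen {a | f a x = y}) : Continuous f := by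
  let _ : TopologicalSpace M := ⊥
  have : DiscreteTopology M := ⟨rfl⟩
  refine continuous_induced_rng.2 (continuous_pi fun x => ?_)
  exact continuous_discrete_rng.2 fun y => hf x y

theorem exists_finset_of_isOpen {U : Set (M ≃[L] M)} (hU : IsOpen U) {g : M ≃[L] M} (hg : g ∈ U) :
    ∃ F : Finset M, ∀ g' : M ≃[L] M, (∀ x ∈ F, g' x = g x) → g' ∈ U := by
  let _ : TopologicalSpace M := ⊥
  obtain ⟨V, hV, rfl⟩ := isOpen_induced_iff.1 hU
  obtain ⟨F, u, hu, hFu⟩ := isOpen_pi_iff.1 hV g hg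
  refine ⟨F, fun g' h => hFu fun x hx => ?_⟩
  change g' x ∈ u x
  rw [h x hx]
  exact (hu x hx).2

theorem isTopologicalGroup_aut : IsTopologicalGroup (M ≃[L] M) where
  continuous_mul := by
    refine continuous_of_isOpen_setOf_apply_eq fun x y => ?_
    have : {a : (M ≃[L] M) × (M ≃[L] M) | (a.1 * a.2) x = y} =
        ⋃ z, {g : M ≃[L] M | g z = y} ×ˢ {g : M ≃[L] M | g x = z} := by
      ext a
      simp [aut_mul_apply]
    rw [this]
    exact isOpen_iUnion fun z => (isOpen_setOf_apply_eq z y).prod (isOpen_setOf_apply_eq x z)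
  continuous_inv := by
    refine continuous_of_isOpen_setOf_apply_eq fun x y => ?_
    simp only [aut_inv_apply_eq]
    exact isOpen_setOf_apply_eq y x

/-- The map `g ↦ (g, g⁻¹)` is a closed embedding into a Polish space. Recording the inverse is what
makes surjectivity a closed condition. -/
theorem polishSpace_aut [L.IsRelational] [Countable M] : PolishSpace (M ≃[L] M) := by
  let _ : TopologicalSpace M := ⊥
  have : DiscreteTopology M := ⟨rfl⟩
  have : IsTopologicalGroup (M ≃[L] M) := isTopologicalGroup_aut
  have hcoe : Topology.IsInducing fun g : M ≃[L] M => (g : M → M) := ⟨rfl⟩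
  let φ : (M ≃[L] M) → (M → M) × (M → M) := fun g => (g, (g⁻¹ : M ≃[L] M))
  have hφ : Continuous φ := hcoe.continuous.prodMk (hcoe.continuous.comp continuous_inv)
  have heval : Continuous fun p : (M → M) × M => p.1 p.2 :=
    continuous_prod_of_discrete_right.2 fun x => continuous_apply x
  have hrange : Set.range φ = {p | (∀ x, p.2 (p.1 x) = x) ∧ (∀ x, p.1 (p.2 x) = x) ∧
      ∀ (R : Σ n, L.Relations n) (x : Fin R.1 → M),
        RelMap R.2 (fun i => p.1 (x i)) ↔ RelMap R.2 x} := by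
    ext p
    constructor
    · rintro ⟨g, rfl⟩
      exact ⟨aut_inv_apply_apply g, aut_apply_inv_apply g, fun R x => equiv_relMap g R.2 x⟩
    · rintro ⟨h1, h2, h3⟩
      exact ⟨equivOfRelMap ⟨p.1, p.2, h1, h2⟩ fun n R x => h3 ⟨n, R⟩ x, rfl⟩
  have hclosed : IsClosed (Set.range φ) := by
    rw [hrange]
    simp only [Set.ofPred_and, Set.ofPred_forall]
    refine IsClosed.inter (isClosed_iInter fun x => ?_) (IsClosed.inter
      (isClosed_iInter fun x => ?_) (isClosed_iInter fun R => isClosed_iInter fun x => ?_))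
    · exact isClosed_eq (heval.comp (continuous_snd.prodMk
        ((continuous_apply x).comp continuous_fst))) continuous_const
    · exact isClosed_eq (heval.comp (continuous_fst.prodMk
        ((continuous_apply x).comp continuous_snd))) continuous_const
    · have hc : Continuous fun p : (M → M) × (M → M) => fun i => p.1 (x i) :=
        continuous_pi fun i => (continuous_apply (x i)).comp continuous_fst
      exact (isClosed_discrete {y : Fin R.1 → M | RelMap R.2 y ↔ RelMap R.2 x}).preimage hc
  have hemb : Topology.IsClosedEmbedding φ :=
    ⟨⟨Topology.IsInducing.of_comp hφ continuous_fst hcoe, fun g h hgh =>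
      DFunLike.coe_injective (congrArg Prod.fst hgh)⟩, hclosed⟩
  have : SecondCountableTopology M := inferInstance
  exact hemb.polishSpace

/-! ### Open and dense sets of tuples of automorphisms -/

variable {ι : Type*}

theorem isOpen_of_forall_exists_finset [Finite ι] {U : Set (ι → (M ≃[L] M))}
    (hU : ∀ h ∈ U, ∃ F : Finset M, ∀ h' : ι → (M ≃[L] M),
      (∀ i, ∀ x ∈ F, h' i x = h i x) → h' ∈ U) : IsOpen U := by
  rw [isOpen_iff_forall_mem_open]
  intro h hh
  obtain ⟨F, hF⟩ := hU h hh
  refine ⟨{h' | ∀ i, ∀ x ∈ F, h' i x = h i x}, hF, ?_, fun _ _ _ => rfl⟩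
  simp only [Set.ofPred_forall]
  exact isOpen_iInter_of_finite fun i => isOpen_biInter_finset fun x _ =>
    (isOpen_setOf_apply_eq x (h i x)).preimage
      (continuous_apply i : Continuous fun k : ι → (M ≃[L] M) => k i)

theorem dense_of_forall_exists {U : Set (ι → (M ≃[L] M))}
    (hU : ∀ (h : ι → (M ≃[L] M)) (F : Finset M), ∃ h' ∈ U, ∀ i, ∀ x ∈ F, h' i x = h i x) :
    Dense U := by
  classical
  rw [dense_iff_inter_open]
  rintro V hV ⟨h, hh⟩
  obtain ⟨I, u, hu, hIu⟩ := isOpen_pi_iff.1 hV h hh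
  have hF : ∀ i, ∃ F : Finset M, i ∈ I → ∀ g' : M ≃[L] M, (∀ x ∈ F, g' x = h i x) → g' ∈ u i := by
    intro i
    by_cases hi : i ∈ I
    · obtain ⟨F, hF⟩ := exists_finset_of_isOpen (hu i hi).1 (hu i hi).2
      exact ⟨F, fun _ => hF⟩
    · exact ⟨∅, fun h => absurd h hi⟩
  choose F hF using hF
  obtain ⟨h', hh', hag⟩ := hU h (I.biUnion F)
  exact ⟨h', hIu fun i hi => hF i hi _ fun x hx => hag i x (Finset.mem_biUnion.2 ⟨i, hi, hx⟩), hh'⟩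

end Topology

/-! ### Generic tuples of automorphisms -/

section Generic

variable {L : FirstOrder.Language.{u, v}} {M : Type w} [L.Structure M] {ι : Type*}

/-- The finite set `A` is invariant under all automorphisms of a tuple. -/
def Invariant (h : ι → (M ≃[L] M)) (A : Finset M) : Prop := ∀ i x, h i x ∈ A ↔ x ∈ A

/-- Each `h i` permutes `A`, so a point sent into `A` by `h' i` has the same image as some point of
`A`, and is that point. -/
theorem Invariant.congr {h h' : ι → (M ≃[L] M)} {A : Finset M} (hA : Invariant h A)
    (hh : ∀ i, ∀ x ∈ A, h' i x = h i x) : Invariant h' A := by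
  intro i x
  constructor
  · intro hx
    have ha : (h i)⁻¹ (h' i x) ∈ A := by
      rw [← hA i, aut_apply_inv_apply]
      exact hx
    have := hh i _ ha
    rw [aut_apply_inv_apply] at this
    rwa [(h' i).injective this] at ha
  · intro hx
    rw [hh i x hx, hA i x]
    exact hx

/-- A tuple of automorphisms is generic when its finite invariant sets are cofinal and each finite
invariant extension of a finite invariant set `A` is realised over `A`. -/
def IsGeneric (h : ι → (M ≃[L] M)) : Prop :=
  (∀ F : Finset M, ∃ D, F ⊆ D ∧ Invariant h D) ∧
  ∀ (A C : Finset M) (k : ι → (M ≃[L] M)), A ⊆ C → Invariant k A → Invariant k C →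
    (∀ i, ∀ a ∈ A, h i a = k i a) →
      ∃ g : M ≃[L] M, (∀ a ∈ A, g a = a) ∧ ∀ i, ∀ c ∈ C, h i (g c) = g (k i c)

/-- Generic tuples form a comeagre set. -/
theorem eventually_isGeneric [L.IsRelational] [Finite (Σ n, L.Relations n)] [Countable M]
    [Nonempty M] [Finite ι] (hU : L.IsUltrahomogeneous M) (hfree : FreeAmalgamation (L.age M)) :
    ∀ᶠ h : ι → (M ≃[L] M) in residual _, IsGeneric h := by
  classical
  have : PolishSpace (M ≃[L] M) := polishSpace_aut
  have := Fintype.ofFinite ι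
  obtain ⟨T, hTc, hTd⟩ := TopologicalSpace.exists_countable_dense (ι → (M ≃[L] M))
  have h1 : ∀ᶠ h : ι → (M ≃[L] M) in residual _, ∀ F : Finset M, ∃ D, F ⊆ D ∧ Invariant h D := by
    refine eventually_countable_forall.2 fun F => residual_of_dense_open
      (isOpen_of_forall_exists_finset ?_) (dense_of_forall_exists ?_)
    · rintro h ⟨D, hFD, hD⟩
      exact ⟨D, fun h' hh' => ⟨D, hFD, hD.congr hh'⟩⟩
    · intro h E
      obtain ⟨k, D, hFD, hk, hD⟩ := exists_finite_invariant hU hfree h (E ∪ F)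
      exact ⟨k, ⟨D, Finset.union_subset_right hFD, hD⟩,
        fun i x hx => hk i x (Finset.mem_union_left _ hx)⟩
  -- There may be uncountably many tuples `k`, but only their restrictions to finite sets matter; a
  -- countable dense set `T` represents all of these.
  have h2 : ∀ᶠ h : ι → (M ≃[L] M) in residual _, ∀ A C : Finset M, ∀ k ∈ T, A ⊆ C →
      Invariant k A → Invariant k C → (∀ i, ∀ a ∈ A, h i a = k i a) →
        ∃ g : M ≃[L] M, (∀ a ∈ A, g a = a) ∧ ∀ i, ∀ c ∈ C, h i (g c) = g (k i c) := by
    refine eventually_countable_forall.2 fun A => eventually_countable_forall.2 fun C =>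
      (eventually_countable_ball hTc).2 fun k _ => residual_of_dense_open
        (isOpen_of_forall_exists_finset ?_) (dense_of_forall_exists ?_)
    · intro h hh
      by_cases hA : ∀ i, ∀ a ∈ A, h i a = k i a
      · by_cases hC : A ⊆ C ∧ Invariant k A ∧ Invariant k C
        · obtain ⟨g, hgA, hgC⟩ := hh hC.1 hC.2.1 hC.2.2 hA
          refine ⟨C.image g, fun h' hh' _ _ _ _ => ⟨g, hgA, fun i c hc => ?_⟩⟩
          rw [hh' i _ (Finset.mem_image_of_mem g hc), hgC i c hc]
        · exact ⟨∅, fun h' _ h1 h2 h3 => absurd ⟨h1, h2, h3⟩ hC⟩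
      · exact ⟨A, fun h' hh' _ _ _ h => absurd (fun i a ha => by rw [← hh' i a ha, h i a ha]) hA⟩
    · intro h F
      by_cases hA : (∀ i, ∀ a ∈ A, h i a = k i a) ∧ A ⊆ C ∧ Invariant k A ∧ Invariant k C
      · obtain ⟨hA, hAC, hkA, hkC⟩ := hA
        -- Adding `A` to `F` keeps the agreement with `k` on `A` while `h` is changed to have a
        -- finite invariant set.
        obtain ⟨h', D, hFD, hh', hD⟩ := exists_finite_invariant hU hfree h (F ∪ A)
        have hh'A : ∀ i, ∀ a ∈ A, h' i a = k i a := fun i a ha => by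
          rw [hh' i a (Finset.mem_union_right _ ha), hA i a ha]
        obtain ⟨l, g, hl, hg, hlg⟩ := exists_joint_realisation hU hfree hAC
          (Finset.union_subset_right hFD) h' k (hkA.congr hh'A) hD hkC hh'A
        refine ⟨l, fun _ _ _ _ => ⟨g, hg, hlg⟩, fun i x hx => ?_⟩
        have hxF := Finset.mem_union_left A hx
        rw [hl i x (hFD hxF), hh' i x hxF]
      · exact ⟨h, fun h1 h2 h3 h4 => absurd ⟨h4, h1, h2, h3⟩ hA, fun _ _ _ => rfl⟩
  filter_upwards [h1, h2] with h hh1 hh2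
  refine ⟨hh1, fun A C k hAC hkA hkC hA => ?_⟩
  have hopen : IsOpen {k' : ι → (M ≃[L] M) | ∀ i, ∀ c ∈ C, k' i c = k i c} :=
    isOpen_of_forall_exists_finset fun k₁ hk₁ => ⟨C, fun k₂ hk₂ i c hc => by
      rw [hk₂ i c hc, hk₁ i c hc]⟩
  obtain ⟨k', hk', hk'T⟩ := hTd.inter_open_nonempty _ hopen ⟨k, fun _ _ _ => rfl⟩
  obtain ⟨g, hgA, hgC⟩ := hh2 A C k' hk'T hAC (hkA.congr fun i a ha => hk' i a (hAC ha))
    (hkC.congr hk') fun i a ha => by rw [hA i a ha, hk' i a (hAC ha)]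
  exact ⟨g, hgA, fun i c hc => by rw [hgC i c hc, hk' i c hc]⟩

/-- The automorphism `g` conjugates `h` to `k` on the finite `h`-invariant set `A`. -/
def ConjugatesOn (h k : ι → (M ≃[L] M)) (g : M ≃[L] M) (A : Finset M) : Prop :=
  Invariant h A ∧ ∀ i, ∀ a ∈ A, g (h i a) = k i (g a)

/-- The tuple `g * h i * g⁻¹` agrees with `k` on the image of `A`. Genericity of `k` realises its
action on the image of a larger invariant set through some `γ` fixing the image of `A`, and `γ * g`
continues the conjugation. -/
theorem ConjugatesOn.exists_forth {h k : ι → (M ≃[L] M)} (hh : IsGeneric h) (hk : IsGeneric k)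
    {g : M ≃[L] M} {A : Finset M} (hg : ConjugatesOn h k g A) (x : M) :
    ∃ (g' : M ≃[L] M) (A' : Finset M), ConjugatesOn h k g' A' ∧ A ⊆ A' ∧ x ∈ A' ∧
      ∀ a ∈ A, g' a = g a := by
  classical
  obtain ⟨A', hAA', hA'⟩ := hh.1 (insert x A)
  have hAA : A ⊆ A' := (Finset.subset_insert _ _).trans hAA'
  have hinv : ∀ B : Finset M, Invariant h B →
      Invariant (fun i => g * h i * g⁻¹) (B.image g) := by
    intro B hB i x
    obtain ⟨x, rfl⟩ := g.surjective x
    simp only [aut_mul_apply, aut_inv_apply_apply]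
    rw [g.injective.mem_finset_image, g.injective.mem_finset_image, hB i x]
  obtain ⟨γ, hγA, hγ⟩ := hk.2 (A.image g) (A'.image g) (fun i => g * h i * g⁻¹)
    (Finset.image_subset_image hAA) (hinv A hg.1) (hinv A' hA') (by
      intro i y hy
      obtain ⟨a, ha, rfl⟩ := Finset.mem_image.1 hy
      simp only [aut_mul_apply, aut_inv_apply_apply]
      exact (hg.2 i a ha).symm)
  refine ⟨γ * g, A', ⟨hA', fun i a ha => ?_⟩, hAA, hAA' (Finset.mem_insert_self _ _),
    fun a ha => hγA _ (Finset.mem_image_of_mem g ha)⟩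
  have := hγ i (g a) (Finset.mem_image_of_mem g ha)
  simp only [aut_mul_apply, aut_inv_apply_apply] at this
  exact this.symm

theorem ConjugatesOn.symm [DecidableEq M] {h k : ι → (M ≃[L] M)} {g : M ≃[L] M} {A : Finset M}
    (hg : ConjugatesOn h k g A) : ConjugatesOn k h g⁻¹ (A.image g) := by
  constructor
  · intro i y
    obtain ⟨x, rfl⟩ := g.surjective y
    rw [g.injective.mem_finset_image]
    constructor
    · intro hx
      obtain ⟨a, ha, hax⟩ := Finset.mem_image.1 hx
      have hb : (h i)⁻¹ a ∈ A := by rwa [← hg.1 i, aut_apply_inv_apply]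
      have := hg.2 i _ hb
      rw [aut_apply_inv_apply, hax] at this
      rwa [g.injective ((k i).injective this)]
    · intro hx
      rw [← hg.2 i x hx]
      exact Finset.mem_image_of_mem g ((hg.1 i x).2 hx)
  · intro i y hy
    obtain ⟨a, ha, rfl⟩ := Finset.mem_image.1 hy
    rw [← hg.2 i a ha, aut_inv_apply_apply, aut_inv_apply_apply]

/-- The back step is the forth step for the inverse, with `h` and `k` exchanged. -/
theorem ConjugatesOn.exists_back_and_forth {h k : ι → (M ≃[L] M)} (hh : IsGeneric h)
    (hk : IsGeneric k) {g : M ≃[L] M} {A : Finset M} (hg : ConjugatesOn h k g A) (x : M) :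
    ∃ (g' : M ≃[L] M) (A' : Finset M), ConjugatesOn h k g' A' ∧ A ⊆ A' ∧ x ∈ A' ∧
      (∃ a ∈ A', g' a = x) ∧ ∀ a ∈ A, g' a = g a := by
  classical
  obtain ⟨g₁, A₁, hg₁, hA₁, hx₁, hgg₁⟩ := hg.exists_forth hh hk x
  obtain ⟨g₂, A₂, hg₂, hA₂, hx₂, hgg₂⟩ := hg₁.symm.exists_forth hk hh x
  have hag : ∀ a ∈ A₁, g₂⁻¹ a = g₁ a := fun a ha => by
    rw [aut_inv_apply_eq, hgg₂ _ (Finset.mem_image_of_mem g₁ ha), aut_inv_apply_apply]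
  have hsub : A₁ ⊆ A₂.image g₂ := fun a ha => Finset.mem_image.2
    ⟨g₁ a, hA₂ (Finset.mem_image_of_mem g₁ ha), by rw [← hag a ha, aut_apply_inv_apply]⟩
  exact ⟨g₂⁻¹, A₂.image g₂, hg₂.symm, hA₁.trans hsub, hsub hx₁,
    ⟨g₂ x, Finset.mem_image_of_mem g₂ hx₂, aut_inv_apply_apply _ _⟩,
    fun a ha => by rw [hag a (hA₁ ha), hgg₁ a ha]⟩

/-- Two generic tuples are conjugate. -/
theorem IsGeneric.exists_conj [L.IsRelational] [Countable M] [Nonempty M]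
    {h k : ι → (M ≃[L] M)} (hh : IsGeneric h) (hk : IsGeneric k) :
    ∃ g : M ≃[L] M, k = fun i => g * h i * g⁻¹ := by
  classical
  obtain ⟨e, he⟩ := exists_surjective_nat M
  let S := {s : (M ≃[L] M) × Finset M // ConjugatesOn h k s.1 s.2}
  have hstep : ∀ (s : S) (x : M), ∃ s' : S, s.1.2 ⊆ s'.1.2 ∧ x ∈ s'.1.2 ∧
      (∃ a ∈ s'.1.2, s'.1.1 a = x) ∧ ∀ a ∈ s.1.2, s'.1.1 a = s.1.1 a := by
    intro s x
    obtain ⟨g', A', hg', h1, h2, h3, h4⟩ := s.2.exists_back_and_forth hh hk x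
    exact ⟨⟨(g', A'), hg'⟩, h1, h2, h3, h4⟩
  choose step hstepA hstepx hstepy hstepag using hstep
  -- The start is the identity on the empty set, where conjugation is vacuous; stage `m + 1` puts `e
  -- m` into both the domain and the image.
  let s : ℕ → S := fun m => Nat.rec ⟨(1, ∅), fun i x => by simp, fun i a ha => by simp at ha⟩
    (fun m s => step s (e m)) m
  have hs : ∀ m, s (m + 1) = step (s m) (e m) := fun m => rfl
  have hmono : Monotone fun m => (s m).1.2 := monotone_nat_of_le_succ fun m => hstepA (s m) (e m)
  have hag : ∀ m m', m ≤ m' → ∀ a ∈ (s m).1.2, (s m').1.1 a = (s m).1.1 a := by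
    intro m m' hm a ha
    induction m', hm using Nat.le_induction with
    | base => rfl
    | succ m' hm ih =>
      rw [hs, hstepag _ _ a (hmono hm ha), ih]
  have hcov : ∀ x, ∃ m, x ∈ (s m).1.2 := fun x => by
    obtain ⟨m, rfl⟩ := he x
    exact ⟨m + 1, hstepx (s m) (e m)⟩
  choose r hr using hcov
  let φ : M → M := fun x => (s (r x)).1.1 x
  have hφ : ∀ m, ∀ x ∈ (s m).1.2, φ x = (s m).1.1 x := by
    intro m x hx
    rcases le_total m (r x) with hm | hm
    · exact hag _ _ hm x hx
    · exact (hag _ _ hm x (hr x)).symm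
  have hbij : Function.Bijective φ := by
    constructor
    · intro x y hxy
      have hx := hmono (le_max_left (r x) (r y)) (hr x)
      have hy := hmono (le_max_right (r x) (r y)) (hr y)
      rw [hφ _ x hx, hφ _ y hy] at hxy
      exact (s _).1.1.injective hxy
    · intro y
      obtain ⟨m, rfl⟩ := he y
      obtain ⟨a, ha, hay⟩ := hstepy (s m) (e m)
      exact ⟨a, (hφ (m + 1) a ha).trans hay⟩
  let g : M ≃[L] M := equivOfRelMap (Equiv.ofBijective φ hbij) fun n R x => by
    -- A finite tuple lies in a single stage, where the limit agrees with an automorphism.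
    have hx : ∀ i, x i ∈ (s (Finset.univ.sup fun i => r (x i))).1.2 := fun i =>
      hmono (Finset.le_sup (f := fun i => r (x i)) (Finset.mem_univ i)) (hr (x i))
    simp only [Equiv.ofBijective_apply, hφ _ _ (hx _)]
    exact equiv_relMap _ R x
  refine ⟨g, funext fun i => ?_⟩
  rw [eq_mul_inv_iff_mul_eq]
  refine FirstOrder.Language.Equiv.ext fun x => ?_
  change k i (φ x) = φ (h i x)
  rw [hφ _ x (hr x), hφ _ _ (((s (r x)).2.1 i x).2 (hr x))]
  exact ((s (r x)).2.2 i x (hr x)).symm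

theorem exists_diagConjOrbit_mem_residual [L.IsRelational] [Finite (Σ n, L.Relations n)]
    [Countable M] (hU : L.IsUltrahomogeneous M) (hfree : FreeAmalgamation (L.age M)) (n : ℕ) :
    ∃ h : Fin n → (M ≃[L] M), diagConjOrbit h ∈ residual (Fin n → (M ≃[L] M)) := by
  have : PolishSpace (M ≃[L] M) := polishSpace_aut
  rcases isEmpty_or_nonempty M with hM | hM
  · refine ⟨1, Filter.mem_of_superset Filter.univ_mem fun k _ => ⟨1, funext fun i => ?_⟩⟩
    exact FirstOrder.Language.Equiv.ext fun x => isEmptyElim x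
  · have hgen := eventually_isGeneric (ι := Fin n) hU hfree
    -- By Baire category a generic tuple exists, and its orbit contains all generic tuples.
    obtain ⟨h, hh⟩ := (dense_of_mem_residual hgen).nonempty
    exact ⟨h, Filter.mem_of_superset hgen fun k hk => IsGeneric.exists_conj hh hk⟩

end Generic

end FreeHomogeneous

theorem theorem5p4 (L : FirstOrder.Language.{u, v}) [L.IsRelational]
    [Finite (Σ n, L.Relations n)] (M : Type w) [L.Structure M] [Countable M]
    (hM : FreeHomogeneous.IsFreeHomogeneous L M) :
    FreeHomogeneous.HasAmpleGenerics (M ≃[L] M) := by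
  obtain ⟨K, hK, hlim⟩ := hM
  have hage : L.age M = K := hlim.age
  exact ⟨FreeHomogeneous.isTopologicalGroup_aut, FreeHomogeneous.polishSpace_aut, fun n _ =>
    FreeHomogeneous.exists_diagConjOrbit_mem_residual hlim.ultrahomogeneous
      (hage ▸ hK.freeAmalgamation) n⟩
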